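/- Let $\Gamma<\mathrm{PSL}(2,\mathbb R)$ be a non-uniform lattice and let $(\Gamma_n)_{n\in\mathbb N}$ be a decreasing sequence of finite-index subgroups of $\Gamma$ with $[\Gamma:\Gamma_n]\to\infty$. Write $S=\Gamma\backslash\mathbb H$, $S_n=\Gamma_n\backslash\mathbb H$, $T^1S=\Gamma\backslash\mathrm{PSL}(2,\mathbb R)$ and $T^1S_n=\Gamma_n\backslash\mathrm{PSL}(2,\mathbb R)$. Let $h_s$ denote the horocycle flow, given on $T^1S$ and on each $T^1S_n$ by right multiplication by $\begin{pmatrix}1&s\\0&1\end{pmatrix}$. Let $$\mathcal Y=\varprojlim\big(T^1S_{n+1}\to T^1S_n\big)$$ be the inverse limit under the covering maps $\Gamma_{n+1}u\mapsto\Gamma_n u$, with the horocycle flow acting coordinatewise, and let $\pi:\mathcal Y\to T^1S$ be the natural projection. Cusps of $S$ (respectively $S_n$) are the orbits under $\Gamma$ (respectively $\Gamma_n$) of the points of $\partial\mathbb H$ fixed by a parabolic element of that group. Let $x=\Gamma u\in T^1S$ be a periodic point of the horocycle flow, and let $\xi$ be the associated cusp of $S$, namely the orbit $\Gamma\, u(\infty)$.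 Let $c_n$ be the number of cusps of $S_n$ which project onto $\xi$ (so that $c_n\le c_{n+1}$ for all $n$), and let $\mathcal M=\pi^{-1}(h_{\mathbb R}(x))$. 1. If $c_n=1$ for all $n$, then $\mathcal M$ is a one-dimensional solenoid and a minimal set for the horocycle flow on $\mathcal Y$. 2. If $\max_n c_n=m\in\mathbb N$, then $\mathcal M$ is the disjoint union of $m$ one-dimensional solenoids, each of which is a minimal set for the horocycle flow on $\mathcal Y$. 3. If $(c_n)$ is unbounded, then $\mathcal M$ is the disjoint union of infinitely many minimal sets for the horocycle flow on $\mathcal Y$. Here a minimal set is a nonempty compact invariant set with no proper nonempty closed invariant subset. A one-dimensional solenoid is a second countable locally compact Hausdorff space covered by open sets $U_i$ with homeomorphisms $\varphi_i:U_i\to(-1,1)\times T_i$, where each $T_i$ is compact, totally disconnected and perfect, and each change of charts has the form $(t,z)\mapsto(a_{ij}(t,z),b_{ij}(z))$ with $a_{ij}(\cdot,z)$ of class $C^\infty$ for fixed $z$; subsets of $\mathcal Y$ carry the subspace topology. -/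

import Mathlib

open Set Filter Topology
open scoped MatrixGroups ContDiff LinearAlgebra.Projectivization

namespace CuspDynamics

noncomputable section

/-! ### Solenoidal manifolds -/

/-- An `n`-dimensional solenoidal manifold: a second countable locally compact Hausdorff space
with an open cover by charts onto `𝔻ⁿ × Tᵢ`, where `𝔻ⁿ` is the open unit disk of `ℝⁿ` and `Tᵢ` is
compact, totally disconnected and perfect, whose changes of charts have the form
`(x, t) ↦ (a x t, b t)`, with `a` smooth in `x` for each fixed `t`. -/
structure IsSolenoidalManifold (n : ℕ) (X : Type*) [TopologicalSpace X] : Prop where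
  secondCountable : SecondCountableTopology X
  locallyCompact : LocallyCompactSpace X
  t2 : T2Space X
  exists_atlas : ∃ (ι : Type) (T : ι → Type) (_ : ∀ i, TopologicalSpace (T i))
    (φ : ∀ i, OpenPartialHomeomorph X (EuclideanSpace ℝ (Fin n) × T i)),
    (∀ i, CompactSpace (T i) ∧ TotallyDisconnectedSpace (T i) ∧ PerfectSpace (T i)) ∧
    (∀ i, (φ i).target = Metric.ball 0 1 ×ˢ univ) ∧
    (∀ x, ∃ i, x ∈ (φ i).source) ∧
    ∀ i j, ∃ (a : EuclideanSpace ℝ (Fin n) → T j → EuclideanSpace ℝ (Fin n)) (b : T j → T i),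
      (∀ p ∈ ((φ j).symm.trans (φ i)).source, φ i ((φ j).symm p) = (a p.1 p.2, b p.2)) ∧
      ∀ t, ContDiffOn ℝ ∞ (fun x => a x t) {x | (x, t) ∈ ((φ j).symm.trans (φ i)).source}

/-! ### Minimal sets and periodic points of flows -/

/-- A compact minimal set of a flow: a nonempty compact invariant set all of whose nonempty
closed invariant subsets are equal to it. -/
structure IsMinimalSet {α : Type*} [TopologicalSpace α] (φ : Flow ℝ α) (K : Set α) : Prop where
  isCompact : IsCompact K
  nonempty : K.Nonempty
  isInvariant : IsInvariant φ K
  eq_of_subset : ∀ L ⊆ K, L.Nonempty → IsClosed L → IsInvariant φ L → L = K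

/-- A point is periodic for a flow if it is fixed by the time-`s` map for some `s > 0`. -/
def IsPeriodic {α : Type*} [TopologicalSpace α] (φ : Flow ℝ α) (x : α) : Prop :=
  ∃ s : ℝ, 0 < s ∧ φ s x = x

/-! ### Unit tangent bundles of quotients of the hyperbolic plane -/

/-- `T¹(Γ \ ℍ) = Γ \ PSL(2, ℝ)`, the space of right cosets `Γ u`, with the quotient topology. -/
def UnitTangent (Γ : Subgroup PSL(2, ℝ)) : Type :=
  MulAction.orbitRel.Quotient Γ PSL(2, ℝ)

instance (Γ : Subgroup PSL(2, ℝ)) : TopologicalSpace (UnitTangent Γ) :=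
  inferInstanceAs (TopologicalSpace (Quotient (MulAction.orbitRel Γ PSL(2, ℝ))))

instance (Γ : Subgroup PSL(2, ℝ)) : MeasurableSpace (UnitTangent Γ) := borel _

instance (Γ : Subgroup PSL(2, ℝ)) : BorelSpace (UnitTangent Γ) := ⟨rfl⟩

/-- The coset `Γ u`. -/
def UnitTangent.mk (Γ : Subgroup PSL(2, ℝ)) (u : PSL(2, ℝ)) : UnitTangent Γ :=
  Quotient.mk (MulAction.orbitRel Γ PSL(2, ℝ)) u

/-- The right action of `PSL(2, ℝ)` on `Γ \ PSL(2, ℝ)`: `Γ u ↦ Γ u g`. -/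
def UnitTangent.rightMul (Γ : Subgroup PSL(2, ℝ)) (g : PSL(2, ℝ)) :
    UnitTangent Γ → UnitTangent Γ :=
  Quotient.map (sa := MulAction.orbitRel Γ PSL(2, ℝ)) (sb := MulAction.orbitRel Γ PSL(2, ℝ))
    (fun u => u * g) (by
      rintro a b ⟨γ, rfl⟩
      exact ⟨γ, (mul_assoc (γ : PSL(2, ℝ)) b g).symm⟩)

/-- For `Γ' ≤ Γ`, the covering map `Γ' \ PSL(2, ℝ) → Γ \ PSL(2, ℝ)`, `Γ' u ↦ Γ u`. -/
def UnitTangent.cover {Γ' Γ : Subgroup PSL(2, ℝ)} (h : Γ' ≤ Γ) : UnitTangent Γ' → UnitTangent Γ :=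
  Quotient.map (sa := MulAction.orbitRel Γ' PSL(2, ℝ)) (sb := MulAction.orbitRel Γ PSL(2, ℝ))
    id (by
      rintro a b ⟨γ, rfl⟩
      exact ⟨⟨γ.1, h γ.2⟩, rfl⟩)

/-- A lattice of `PSL(2, ℝ)`: a discrete subgroup `Γ` such that `Γ \ PSL(2, ℝ)` carries a nonzero
finite Borel measure invariant under the right action of `PSL(2, ℝ)`. -/
def IsLattice (Γ : Subgroup PSL(2, ℝ)) : Prop :=
  DiscreteTopology Γ ∧
    ∃ μ : MeasureTheory.Measure (UnitTangent Γ), μ ≠ 0 ∧ MeasureTheory.IsFiniteMeasure μ ∧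
      ∀ g : PSL(2, ℝ), μ.map (UnitTangent.rightMul Γ g) = μ

/-- A non-uniform lattice: a lattice whose quotient is not compact. -/
def IsNonuniformLattice (Γ : Subgroup PSL(2, ℝ)) : Prop :=
  IsLattice Γ ∧ ¬ CompactSpace (UnitTangent Γ)

/-! ### The horocycle flow -/

/-- The matrix `(1 s; 0 1)`. -/
def unipotentSL (s : ℝ) : SL(2, ℝ) := ⟨!![1, s; 0, 1], by simp⟩

/-- The class of `(1 s; 0 1)` in `PSL(2, ℝ)`. -/
def unipotent (s : ℝ) : PSL(2, ℝ) := (unipotentSL s : PSL(2, ℝ))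

lemma unipotent_zero : unipotent 0 = 1 := by
  have : unipotentSL 0 = 1 := by
    ext i j; fin_cases i <;> fin_cases j <;> simp [unipotentSL]
  rw [unipotent, this]; rfl

lemma unipotent_add (s t : ℝ) : unipotent (s + t) = unipotent t * unipotent s := by
  have : unipotentSL (s + t) = unipotentSL t * unipotentSL s := by
    apply Subtype.ext
    change !![1, s + t; 0, 1] = !![1, t; 0, 1] * !![1, s; 0, 1]
    simp
  rw [unipotent, this]; rfl

lemma continuous_unipotent : Continuous unipotent := by
  refine continuous_quotient_mk'.comp (Continuous.subtype_mk ?_ _)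
  refine continuous_matrix fun i j => ?_
  fin_cases i <;> fin_cases j <;> simp <;> fun_prop

/-- The horocycle flow on `Γ \ PSL(2, ℝ)`: `h_s (Γ u) = Γ u (1 s; 0 1)`. -/
def horocycleFlow (Γ : Subgroup PSL(2, ℝ)) : Flow ℝ (UnitTangent Γ) where
  toFun s := UnitTangent.rightMul Γ (unipotent s)
  cont' := by
    have hq : IsOpenQuotientMap (Prod.map id (UnitTangent.mk Γ) :
        ℝ × PSL(2, ℝ) → ℝ × UnitTangent Γ) :=
      IsOpenQuotientMap.id.prodMap MulAction.isOpenQuotientMap_quotientMk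
    rw [← hq.continuous_comp_iff]
    have : Continuous fun p : ℝ × PSL(2, ℝ) => p.2 * unipotent p.1 :=
      continuous_snd.mul (continuous_unipotent.comp continuous_fst)
    exact (continuous_quotient_mk' (s := MulAction.orbitRel Γ PSL(2, ℝ))).comp this
  map_add' s t x := by
    induction x using Quotient.inductionOn with
    | h u =>
      change UnitTangent.mk Γ (u * unipotent (s + t)) =
        UnitTangent.mk Γ (u * unipotent t * unipotent s)
      rw [unipotent_add, mul_assoc]
  map_zero' x := by
    induction x using Quotient.inductionOn with
    | h u =>
      change UnitTangent.mk Γ (u * unipotent 0) = UnitTangent.mk Γ u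
      rw [unipotent_zero, mul_one]

lemma continuous_cover {Γ' Γ : Subgroup PSL(2, ℝ)} (h : Γ' ≤ Γ) :
    Continuous (UnitTangent.cover h) :=
  continuous_id.quotient_map' _

lemma cover_horocycleFlow {Γ' Γ : Subgroup PSL(2, ℝ)} (h : Γ' ≤ Γ) (s : ℝ) (x : UnitTangent Γ') :
    UnitTangent.cover h (horocycleFlow Γ' s x) = horocycleFlow Γ s (UnitTangent.cover h x) := by
  induction x using Quotient.inductionOn with
  | h u => rfl

/-! ### The inverse limit of a tower of coverings -/

/-- The inverse limit `𝒴` of the tower `⋯ → Γₙ₊₁ \ PSL(2, ℝ) → Γₙ \ PSL(2, ℝ) → ⋯` defined by a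
decreasing sequence of subgroups, as a subspace of the product. -/
def InverseLimit (Γn : ℕ → Subgroup PSL(2, ℝ)) (hanti : Antitone Γn) : Type :=
  {y : ∀ n, UnitTangent (Γn n) //
    ∀ n, UnitTangent.cover (hanti n.le_succ) (y (n + 1)) = y n}

instance (Γn : ℕ → Subgroup PSL(2, ℝ)) (hanti : Antitone Γn) :
    TopologicalSpace (InverseLimit Γn hanti) :=
  inferInstanceAs (TopologicalSpace (Subtype _))

/-- The natural projection `π : 𝒴 → Γ \ PSL(2, ℝ)`. -/
def InverseLimit.proj {Γ : Subgroup PSL(2, ℝ)} {Γn : ℕ → Subgroup PSL(2, ℝ)}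
    (hanti : Antitone Γn) (hle : ∀ n, Γn n ≤ Γ) (y : InverseLimit Γn hanti) : UnitTangent Γ :=
  UnitTangent.cover (hle 0) (y.1 0)

/-- The horocycle flow on the inverse limit, acting in each coordinate. -/
def InverseLimit.horocycleFlow (Γn : ℕ → Subgroup PSL(2, ℝ)) (hanti : Antitone Γn) :
    Flow ℝ (InverseLimit Γn hanti) where
  toFun s y := ⟨fun n => CuspDynamics.horocycleFlow (Γn n) s (y.1 n), fun n => by
    rw [cover_horocycleFlow, y.2 n]⟩
  cont' := by
    refine Continuous.subtype_mk (continuous_pi fun n => ?_) _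
    exact (CuspDynamics.horocycleFlow (Γn n)).continuous continuous_fst
      ((continuous_apply n).comp (continuous_subtype_val.comp continuous_snd))
  map_add' s t y := Subtype.ext (funext fun n =>
    Flow.map_add (CuspDynamics.horocycleFlow (Γn n)) s t (y.1 n))
  map_zero' y := Subtype.ext (funext fun n =>
    Flow.map_zero_apply (CuspDynamics.horocycleFlow (Γn n)) (y.1 n))

/-! ### Cusps -/

/-- The boundary at infinity `∂ℍ = ℙ¹(ℝ)`, on which `PSL(2, ℝ)` acts by Möbius transformations. -/
abbrev Boundary : Type := ℙ ℝ (Fin 2 → ℝ)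

/-- The point `∞ = [1 : 0]` of `∂ℍ`. -/
def boundaryInfty : Boundary := Projectivization.mk ℝ ![1, 0] (by simp)

/-- A parabolic fixed point of `Γ`: a point of `∂ℍ` fixed by a parabolic element of `Γ`. -/
def IsParabolicPoint (Γ : Subgroup PSL(2, ℝ)) (η : Boundary) : Prop :=
  ∃ g : SL(2, ℝ), (g : PSL(2, ℝ)) ∈ Γ ∧ g.1.IsParabolic ∧ (g : PSL(2, ℝ)) • η = η

/-- The cusps of `Γ \ ℍ`: the `Γ`-orbits of parabolic fixed points of `Γ`. -/
def cusps (Γ : Subgroup PSL(2, ℝ)) : Set (MulAction.orbitRel.Quotient Γ Boundary) :=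
  (Quotient.mk (MulAction.orbitRel Γ Boundary)) '' {η | IsParabolicPoint Γ η}

/-- For `Γ' ≤ Γ`, the map `Γ' \ ∂ℍ → Γ \ ∂ℍ` induced by the covering `Γ' \ ℍ → Γ \ ℍ`. -/
def boundaryCover {Γ' Γ : Subgroup PSL(2, ℝ)} (h : Γ' ≤ Γ) :
    MulAction.orbitRel.Quotient Γ' Boundary → MulAction.orbitRel.Quotient Γ Boundary :=
  Quotient.map (sa := MulAction.orbitRel Γ' Boundary) (sb := MulAction.orbitRel Γ Boundary)
    id (by
      rintro a b ⟨γ, rfl⟩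
      exact ⟨⟨γ.1, h γ.2⟩, rfl⟩)

/-- The number of cusps of `Γ' \ ℍ` which project onto the cusp `ξ` of `Γ \ ℍ`. -/
def numCuspsOver {Γ' Γ : Subgroup PSL(2, ℝ)} (h : Γ' ≤ Γ)
    (ξ : MulAction.orbitRel.Quotient Γ Boundary) : ℕ :=
  {C | C ∈ cusps Γ' ∧ boundaryCover h C = ξ}.ncard

/-- The class in `Γ \ ∂ℍ` of the end point `u(+∞) = u • ∞` of the geodesic ray defined by the unit
tangent vector `x = Γ u`. When `x` is periodic for the horocycle flow this is the cusp associated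
to `x`, see `endpointClass_mem_cusps`. -/
def endpointClass (Γ : Subgroup PSL(2, ℝ)) :
    UnitTangent Γ → MulAction.orbitRel.Quotient Γ Boundary :=
  Quotient.map (sa := MulAction.orbitRel Γ PSL(2, ℝ)) (sb := MulAction.orbitRel Γ Boundary)
    (fun u => u • boundaryInfty) (by
      rintro a b ⟨γ, rfl⟩
      exact ⟨γ, (mul_smul (γ : PSL(2, ℝ)) b boundaryInfty).symm⟩)

lemma unipotent_smul_infty (s : ℝ) : unipotent s • boundaryInfty = boundaryInfty := by
  rw [unipotent, Matrix.ProjectiveSpecialLinearGroup.smul_proj_mk, boundaryInfty,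
    Projectivization.smul_mk, Projectivization.mk_eq_mk_iff']
  refine ⟨1, ?_⟩
  change _ = (unipotentSL s).1.mulVec ![1, 0]
  ext i; fin_cases i <;> simp [unipotentSL, Matrix.mulVec, dotProduct]

/-- A periodic point of the horocycle flow is associated to a cusp. -/
lemma endpointClass_mem_cusps {Γ : Subgroup PSL(2, ℝ)} {x : UnitTangent Γ}
    (hx : IsPeriodic (horocycleFlow Γ) x) : endpointClass Γ x ∈ cusps Γ := by
  obtain ⟨s, hs, hsx⟩ := hx
  induction x using Quotient.inductionOn with
  | h u =>
    refine ⟨u • boundaryInfty, ?_, rfl⟩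
    obtain ⟨γ, hγ⟩ := Quotient.exact hsx
    have hγ' : (γ : PSL(2, ℝ)) * u = u * unipotent s := hγ
    have hγ2 : (γ : PSL(2, ℝ)) = u * unipotent s * u⁻¹ := by rw [← hγ']; group
    obtain ⟨v, rfl⟩ := QuotientGroup.mk_surjective u
    have hcoe : ((v * unipotentSL s * v⁻¹ : SL(2, ℝ)) : PSL(2, ℝ)) = γ := by rw [hγ2]; rfl
    refine ⟨v * unipotentSL s * v⁻¹, hcoe ▸ γ.2, ?_, ?_⟩
    · have hp : (unipotentSL s).1.IsParabolic := by
        constructor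
        · rintro ⟨a, ha⟩
          have := congrFun (congrFun ha 0) 1
          simp [unipotentSL] at this
          exact hs.ne this
        · simp [unipotentSL, Matrix.discr_fin_two, Matrix.trace_fin_two, Matrix.det_fin_two]
          norm_num
      have := (Matrix.isParabolic_conj_iff (v : GL (Fin 2) ℝ)).2 hp
      rwa [← Matrix.coe_units_inv, ← map_inv] at this
    · rw [hcoe, smul_smul, hγ', mul_smul, unipotent_smul_infty]

end

end CuspDynamics

namespace CuspDynamics

/-! ### Topology of `PSL(2, ℝ)` and of its quotients -/

/-! Let s be the least period of the horocycle of x. The fibre π⁻¹(x) is an inverse limit of finite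
fibres, hence compact and totally disconnected, and 𝓜 is its suspension with return time s. A point
of 𝓜 has an end at each level n (`cuspAt`), which is constant along the flow. The sets on which the
ends at all levels are prescribed (`component`) partition 𝓜.

Each component is minimal. An element of Γ fixing the end of a closed horocycle must preserve its
period group sℤ, so it is unipotent (`exists_unipotent_of_smul_eq`). Hence at level n two closed
horocycles over that of x with the same end coincide (`exists_horocycleFlow_eq`). An orbit in a
component therefore reaches the n-th coordinate of any other point of the component, for every n,
and is dense there.

The ends at level n are exactly the cusps of Sₙ over ξ (`cusps_over_eq_cuspAt_image`), so cₙ counts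
them. If cₙ is maximal at n = N, the end at level N determines the ends at all levels. There are
then c_N components, and each meets π⁻¹(x) in a set that is perfect because the indices tend to
infinity (`perfectSpace_transversal`); its suspension is a solenoid
(`IsTransversal.isSolenoidalManifold`). If (cₙ) is unbounded, there are at least cₙ components for
every n. -/

lemma isClosedEmbedding_coe_SL2 :
    IsClosedEmbedding ((↑) : SL(2, ℝ) → Matrix (Fin 2) (Fin 2) ℝ) := by
  refine ⟨IsEmbedding.subtypeVal, ?_⟩
  rw [Subtype.range_coe_subtype]
  exact isClosed_eq (Continuous.matrix_det continuous_id) continuous_const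

instance : LocallyCompactSpace SL(2, ℝ) :=
  have : LocallyCompactSpace (Matrix (Fin 2) (Fin 2) ℝ) :=
    inferInstanceAs (LocallyCompactSpace (Fin 2 → Fin 2 → ℝ))
  isClosedEmbedding_coe_SL2.locallyCompactSpace (Y := Matrix (Fin 2) (Fin 2) ℝ)

instance : SecondCountableTopology (Matrix (Fin 2) (Fin 2) ℝ) :=
  inferInstanceAs (SecondCountableTopology (Fin 2 → Fin 2 → ℝ))

instance : SecondCountableTopology SL(2, ℝ) :=
  isClosedEmbedding_coe_SL2.isEmbedding.secondCountableTopology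

instance : LocallyCompactSpace PSL(2, ℝ) :=
  QuotientGroup.isOpenQuotientMap_mk.locallyCompactSpace

instance : SecondCountableTopology PSL(2, ℝ) :=
  QuotientGroup.instSecondCountableTopology (Subgroup.center SL(2, ℝ))

lemma isClosed_center_SL2 : IsClosed (Subgroup.center SL(2, ℝ) : Set SL(2, ℝ)) := by
  rw [Subgroup.coe_center, ← Set.centralizer_univ]
  exact Set.isClosed_centralizer univ

instance : T2Space PSL(2, ℝ) :=
  have := isClosed_center_SL2
  have : T3Space PSL(2, ℝ) := QuotientGroup.instT3Space (Subgroup.center SL(2, ℝ))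
  inferInstance

instance (Γ : Subgroup PSL(2, ℝ)) : SecondCountableTopology (UnitTangent Γ) :=
  ContinuousConstSMul.secondCountableTopology (Γ := Γ) (T := PSL(2, ℝ))

instance (Γ : Subgroup PSL(2, ℝ)) [DiscreteTopology Γ] : T2Space (UnitTangent Γ) :=
  have : ProperlyDiscontinuousSMul Γ PSL(2, ℝ) :=
    Subgroup.properlyDiscontinuousSMul_of_tendsto_cofinite Γ
      (Subgroup.tendsto_coe_cofinite_of_discrete Γ ⟨‹_›⟩)
  t2Space_of_properlyDiscontinuousSMul_of_t2Space (Γ := Γ) (T := PSL(2, ℝ))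

/-! ### Cosets and unipotent elements -/

lemma UnitTangent.mk_eq_mk_iff {Γ : Subgroup PSL(2, ℝ)} {u v : PSL(2, ℝ)} :
    UnitTangent.mk Γ u = UnitTangent.mk Γ v ↔ ∃ γ ∈ Γ, γ * v = u := by
  refine ⟨fun h => ?_, ?_⟩
  · obtain ⟨γ, hγ⟩ := Quotient.exact h
    exact ⟨γ, γ.2, hγ⟩
  · rintro ⟨γ, hγ, rfl⟩
    exact Quotient.sound ⟨⟨γ, hγ⟩, rfl⟩

lemma UnitTangent.mk_surjective (Γ : Subgroup PSL(2, ℝ)) :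
    Function.Surjective (UnitTangent.mk Γ) :=
  Quotient.mk_surjective

lemma horocycleFlow_mk (Γ : Subgroup PSL(2, ℝ)) (t : ℝ) (u : PSL(2, ℝ)) :
    horocycleFlow Γ t (UnitTangent.mk Γ u) = UnitTangent.mk Γ (u * unipotent t) :=
  rfl

lemma cover_mk {Γ' Γ : Subgroup PSL(2, ℝ)} (h : Γ' ≤ Γ) (u : PSL(2, ℝ)) :
    UnitTangent.cover h (UnitTangent.mk Γ' u) = UnitTangent.mk Γ u :=
  rfl

lemma unipotent_eq_one_iff {t : ℝ} : unipotent t = 1 ↔ t = 0 := by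
  refine ⟨fun h => ?_, fun h => h ▸ unipotent_zero⟩
  obtain ⟨r, -, hr⟩ := Matrix.SpecialLinearGroup.mem_center_iff.1
    ((QuotientGroup.eq_one_iff (unipotentSL t)).1 h)
  simpa [unipotentSL] using (congrFun (congrFun hr 0) 1).symm

lemma horocycleFlow_mk_eq_iff {Γ : Subgroup PSL(2, ℝ)} {t : ℝ} {u : PSL(2, ℝ)} :
    horocycleFlow Γ t (UnitTangent.mk Γ u) = UnitTangent.mk Γ u ↔ u * unipotent t * u⁻¹ ∈ Γ := by
  rw [horocycleFlow_mk, UnitTangent.mk_eq_mk_iff]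
  refine ⟨?_, fun h => ⟨_, h, by group⟩⟩
  rintro ⟨γ, hγ, h⟩
  rwa [← h, mul_inv_cancel_right]

/-- The additive group of periods of a point under a flow. -/
def flowPeriods {α : Type*} [TopologicalSpace α] (φ : Flow ℝ α) (x : α) : AddSubgroup ℝ where
  carrier := {t | φ t x = x}
  zero_mem' := φ.map_zero_apply x
  add_mem' {s t} hs ht := by
    rw [mem_ofPred_eq] at hs ht ⊢
    rw [φ.map_add, ht, hs]
  neg_mem' {t} ht := by
    rw [mem_ofPred_eq] at ht ⊢
    nth_rw 1 [← ht]
    rw [← φ.map_add, neg_add_cancel, φ.map_zero_apply]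

lemma mem_flowPeriods {α : Type*} [TopologicalSpace α] {φ : Flow ℝ α} {x : α} {t : ℝ} :
    t ∈ flowPeriods φ x ↔ φ t x = x :=
  Iff.rfl

/-- The periods of a periodic horocycle are the multiples of a least period. -/
lemma exists_period {Γ : Subgroup PSL(2, ℝ)} [DiscreteTopology Γ] {x : UnitTangent Γ}
    (hx : IsPeriodic (horocycleFlow Γ) x) :
    ∃ s : ℝ, 0 < s ∧
      ∀ t, horocycleFlow Γ t x = x ↔ t ∈ AddSubgroup.zmultiples s := by
  obtain ⟨r, hr, hrx⟩ := hx
  obtain ⟨u, rfl⟩ := UnitTangent.mk_surjective Γ x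
  -- Discreteness isolates 1 in Γ, so by continuity 0 is isolated among the periods, and a subgroup
  -- of ℝ in which 0 is isolated is cyclic.
  have hnhds : ∀ᶠ g in 𝓝 (1 : PSL(2, ℝ)), g ∈ Γ → g = 1 := by
    have h1 : {(1 : Γ)} ∈ 𝓝 (1 : Γ) := (isOpen_discrete _).mem_nhds rfl
    rw [nhds_subtype, mem_comap] at h1
    obtain ⟨V, hV, h⟩ := h1
    filter_upwards [hV] with g hg hgΓ
    exact congrArg Subtype.val (h (show (⟨g, hgΓ⟩ : Γ) ∈ _ from hg))
  have hcont : Tendsto (fun t => u * unipotent t * u⁻¹) (𝓝 0) (𝓝 1) := by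
    have : Continuous fun t => u * unipotent t * u⁻¹ :=
      (continuous_const.mul continuous_unipotent).mul continuous_const
    simpa [unipotent_zero] using this.tendsto 0
  obtain ⟨ε, hε, hsep⟩ := Metric.eventually_nhds_iff.1 (hcont.eventually hnhds)
  have hdisj : Disjoint (flowPeriods (horocycleFlow Γ) (UnitTangent.mk Γ u) : Set ℝ)
      (Ioo 0 ε) := by
    rw [Set.disjoint_left]
    rintro t ht ⟨h0, h1⟩
    have := hsep (by simpa [abs_of_pos h0] using h1) (horocycleFlow_mk_eq_iff.1 ht)
    rw [mul_inv_eq_one, mul_eq_left, unipotent_eq_one_iff] at this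
    exact h0.ne' this
  obtain ⟨b, hb⟩ := AddSubgroup.cyclic_of_isolated_zero hε hdisj
  rw [← AddSubgroup.zmultiples_eq_closure] at hb
  have hb0 : b ≠ 0 := by
    rintro rfl
    have : r ∈ flowPeriods (horocycleFlow Γ) (UnitTangent.mk Γ u) := hrx
    rw [hb, AddSubgroup.zmultiples_zero_eq_bot, AddSubgroup.mem_bot] at this
    exact hr.ne' this
  refine ⟨|b|, abs_pos.2 hb0, fun t => ?_⟩
  rw [← mem_flowPeriods, hb]
  rcases abs_choice b with h | h <;> rw [h]
  rw [AddSubgroup.zmultiples_neg]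

/-! ### Stabilizers of cusps in a discrete group -/

lemma exists_upperTriangular_of_smul_infty {g : SL(2, ℝ)}
    (hg : (g : PSL(2, ℝ)) • boundaryInfty = boundaryInfty) : g.1 1 0 = 0 := by
  rw [Matrix.ProjectiveSpecialLinearGroup.smul_proj_mk, boundaryInfty,
    Projectivization.smul_mk, Projectivization.mk_eq_mk_iff'] at hg
  obtain ⟨r, hr⟩ := hg
  have h : r • ![1, 0] = g.1.mulVec ![1, 0] := hr
  simpa [Matrix.mulVec, dotProduct] using (congrFun h 1).symm

/-- The diagonal of `g` is (a, a⁻¹), so conjugation rescales horocycle time by a². Discreteness will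
force this factor to be 1. -/
lemma conj_unipotent {g : SL(2, ℝ)} (hg : g.1 1 0 = 0) (t : ℝ) :
    (g : PSL(2, ℝ)) * unipotent t * (g : PSL(2, ℝ))⁻¹ = unipotent (g.1 0 0 ^ 2 * t) := by
  have hdet := g.2
  rw [Matrix.det_fin_two, hg, mul_zero, sub_zero] at hdet
  have : g * unipotentSL t = unipotentSL (g.1 0 0 ^ 2 * t) * g := by
    apply Subtype.ext
    change g.1 * !![1, t; 0, 1] = !![1, g.1 0 0 ^ 2 * t; 0, 1] * g.1
    ext i j
    fin_cases i <;> fin_cases j <;> simp [Matrix.mul_apply, hg]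
    linear_combination (-(g.1 0 0) * t) * hdet
  rw [mul_inv_eq_iff_eq_mul]
  exact congrArg (QuotientGroup.mk : SL(2, ℝ) → PSL(2, ℝ)) this

lemma exists_unipotent_of_sq_eq_one {g : SL(2, ℝ)} (hg : g.1 1 0 = 0) (h : g.1 0 0 ^ 2 = 1) :
    ∃ t, (g : PSL(2, ℝ)) = unipotent t := by
  have hdet := g.2
  rw [Matrix.det_fin_two, hg, mul_zero, sub_zero] at hdet
  have hd : g.1 1 1 = g.1 0 0 := by
    linear_combination (g.1 0 0) * hdet - g.1 1 1 * h
  -- With a = d = ±1 one has g = a · (1 ab; 0 1), and the sign a disappears in PSL(2, ℝ).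
  refine ⟨g.1 0 0 * g.1 0 1, ?_⟩
  rw [unipotent, QuotientGroup.eq, Matrix.SpecialLinearGroup.mem_center_iff]
  refine ⟨g.1 0 0, by simpa using h, ?_⟩
  rw [Matrix.SpecialLinearGroup.coe_mul, Matrix.SpecialLinearGroup.coe_inv,
    Matrix.adjugate_fin_two]
  ext i j
  fin_cases i <;> fin_cases j <;> simp [unipotentSL, Matrix.mul_apply, hg, hd]
  linear_combination (-(g.1 0 1)) * h

/-- In a discrete group, an element fixing the cusp of a closed horocycle is unipotent. -/
lemma exists_unipotent_of_smul_eq {Γ : Subgroup PSL(2, ℝ)} [DiscreteTopology Γ]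
    {u : PSL(2, ℝ)} (hx : IsPeriodic (horocycleFlow Γ) (UnitTangent.mk Γ u)) {σ : PSL(2, ℝ)}
    (hσ : σ ∈ Γ) (hfix : σ • u • boundaryInfty = u • boundaryInfty) :
    ∃ t, σ * u = u * unipotent t := by
  obtain ⟨s, hs, hper⟩ := exists_period hx
  obtain ⟨g, hg⟩ := QuotientGroup.mk_surjective (u⁻¹ * σ * u)
  have hg10 : g.1 1 0 = 0 := by
    apply exists_upperTriangular_of_smul_infty
    rw [hg, mul_smul, mul_smul, hfix, inv_smul_smul]
  have hσu : σ * u = u * (g : PSL(2, ℝ)) := by rw [hg]; group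
  have hdet := g.2
  rw [Matrix.det_fin_two, hg10, mul_zero, sub_zero] at hdet
  -- Conjugation by σ ∈ Γ preserves membership in Γ and multiplies the unipotent parameter by a².
  -- Thus a² maps sℤ onto itself, which makes both a² and a⁻² integers.
  have hstep : ∀ t, t ∈ AddSubgroup.zmultiples s ↔ g.1 0 0 ^ 2 * t ∈ AddSubgroup.zmultiples s := by
    intro t
    rw [← hper, ← hper, horocycleFlow_mk_eq_iff, horocycleFlow_mk_eq_iff, ← conj_unipotent hg10]
    have : u * ((g : PSL(2, ℝ)) * unipotent t * (g : PSL(2, ℝ))⁻¹) * u⁻¹ =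
        σ * (u * unipotent t * u⁻¹) * σ⁻¹ := by
      rw [hg]; group
    rw [this, Subgroup.mul_mem_cancel_right _ (inv_mem hσ), Subgroup.mul_mem_cancel_left _ hσ]
  have ha : g.1 0 0 ≠ 0 := fun h => by simp [h] at hdet
  obtain ⟨k, hk⟩ := AddSubgroup.mem_zmultiples_iff.1
    ((hstep s).1 (AddSubgroup.mem_zmultiples s))
  obtain ⟨l, hl⟩ := AddSubgroup.mem_zmultiples_iff.1
    ((hstep ((g.1 0 0 ^ 2)⁻¹ * s)).2 (by
      rw [mul_inv_cancel_left₀ (pow_ne_zero 2 ha)]; exact AddSubgroup.mem_zmultiples s))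
  rw [zsmul_eq_mul] at hk hl
  have hk' : (k : ℝ) = g.1 0 0 ^ 2 := mul_right_cancel₀ hs.ne' hk
  have hl' : (l : ℝ) = (g.1 0 0 ^ 2)⁻¹ := mul_right_cancel₀ hs.ne' hl
  have hkl : k * l = 1 := by
    have : (k * l : ℝ) = 1 := by rw [hk', hl', mul_inv_cancel₀ (pow_ne_zero 2 ha)]
    exact_mod_cast this
  have hkpos : 0 < k := by
    have : (0 : ℝ) < k := by rw [hk']; positivity
    exact_mod_cast this
  have hk1 : k = 1 := by
    rcases Int.eq_one_or_neg_one_of_mul_eq_one hkl with h | h <;> omega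
  obtain ⟨t, ht⟩ := exists_unipotent_of_sq_eq_one hg10 (by rw [← hk', hk1]; simp)
  exact ⟨t, by rw [hσu, ht]⟩

end CuspDynamics

namespace CuspDynamics

/-! ### Suspensions of totally disconnected transversals -/

/-- `F` is a compact transversal of the flow `φ` whose times of return are exactly the multiples
of `s > 0`. -/
structure IsTransversal {X : Type} [TopologicalSpace X] (φ : Flow ℝ X) (F : Set X) (s : ℝ) :
    Prop where
  isCompact : IsCompact F
  pos : 0 < s
  mapsTo : ∀ k : ℤ, ∀ z ∈ F, φ (k • s) z ∈ F
  return_time : ∀ z ∈ F, ∀ t, φ t z ∈ F → t ∈ AddSubgroup.zmultiples s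

/-- The saturation of a set under a flow. -/
def flowSaturation {X : Type} [TopologicalSpace X] (φ : Flow ℝ X) (F : Set X) : Set X :=
  {y | ∃ t : ℝ, ∃ z ∈ F, φ t z = y}

namespace IsTransversal

variable {X : Type} [TopologicalSpace X] {φ : Flow ℝ X} {F : Set X} {s : ℝ}

lemma exists_return (h : IsTransversal φ F s) {t t' : ℝ} {z z' : X} (hz : z ∈ F) (hz' : z' ∈ F)
    (heq : φ t z = φ t' z') : ∃ k : ℤ, t - t' = k * s ∧ z' = φ (k * s) z := by
  have hz1 : z' = φ (t - t') z := by
    rw [sub_eq_neg_add, φ.map_add, heq, ← φ.map_add, neg_add_cancel, φ.map_zero_apply]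
  obtain ⟨k, hk⟩ := AddSubgroup.mem_zmultiples_iff.1 (h.return_time z hz (t - t') (hz1 ▸ hz'))
  rw [zsmul_eq_mul] at hk
  exact ⟨k, hk.symm, hk ▸ hz1⟩

/-- Return times are multiples of `s`, so suspension coordinates are unique in any time window
shorter than `s`. -/
lemma eq_of_abs_sub_lt (h : IsTransversal φ F s) {t t' : ℝ} {z z' : X} (hz : z ∈ F)
    (hz' : z' ∈ F) (heq : φ t z = φ t' z') (hlt : |t - t'| < s) : t = t' ∧ z = z' := by
  obtain ⟨k, hk, hzz⟩ := h.exists_return hz hz' heq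
  have hk0 : k = 0 := by
    rw [hk, abs_mul, abs_of_pos h.pos, mul_lt_iff_lt_one_left h.pos] at hlt
    exact Int.abs_lt_one_iff.1 (by exact_mod_cast hlt)
  subst hk0
  simp only [Int.cast_zero, zero_mul, φ.map_zero_apply] at hk hzz
  exact ⟨sub_eq_zero.1 hk, hzz.symm⟩

lemma exists_mem_Ico (h : IsTransversal φ F s) (a : ℝ) {y : X} (hy : y ∈ flowSaturation φ F) :
    ∃ t ∈ Ico a (a + s), ∃ z ∈ F, φ t z = y := by
  obtain ⟨t, z, hz, rfl⟩ := hy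
  refine ⟨toIcoMod h.pos a t, toIcoMod_mem_Ico h.pos a t,
    φ (toIcoDiv h.pos a t • s) z, h.mapsTo _ z hz, ?_⟩
  rw [← φ.map_add, toIcoMod_add_toIcoDiv_zsmul]

/-- The suspension parametrization of the saturation of a transversal. -/
def suspend (φ : Flow ℝ X) (F : Set X) (p : ℝ × F) : flowSaturation φ F :=
  ⟨φ p.1 p.2, p.1, p.2, p.2.2, rfl⟩

lemma continuous_suspend : Continuous (suspend φ F) :=
  (φ.continuous continuous_fst (continuous_subtype_val.comp continuous_snd)).subtype_mk _

lemma compactSpace_saturation (h : IsTransversal φ F s) :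
    CompactSpace (flowSaturation φ F) := by
  have := isCompact_iff_compactSpace.1 h.isCompact
  have : suspend φ F '' (Icc 0 s ×ˢ univ) = univ := by
    refine eq_univ_of_forall fun y => ?_
    obtain ⟨t, ht, z, hz, hy⟩ := h.exists_mem_Ico 0 y.2
    rw [zero_add] at ht
    exact ⟨(t, ⟨z, hz⟩), ⟨Ico_subset_Icc_self ht, mem_univ _⟩, Subtype.ext hy⟩
  rw [← isCompact_univ_iff, ← this]
  exact (isCompact_Icc.prod isCompact_univ).image continuous_suspend

/-- The closed window from c - s/4 to c + 3s/4 has length s, so it parametrizes the whole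
saturation. Its times differ by less than s from those of `W`, so the complement of the image of `W`
is the image of the window minus `W`, which is compact. -/
lemma isOpen_suspend_image [T2Space X] (h : IsTransversal φ F s) {c : ℝ} {W : Set (ℝ × F)}
    (hW : IsOpen W) (hsub : W ⊆ Ioo (c - s / 4) (c + s / 4) ×ˢ univ) :
    IsOpen (suspend φ F '' W) := by
  have := isCompact_iff_compactSpace.1 h.isCompact
  have hs := h.pos
  have : (suspend φ F '' W)ᶜ =
      suspend φ F '' ((Icc (c - s / 4) (c + 3 * s / 4) ×ˢ univ) \ W) := by
    ext y
    constructor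
    · intro hy
      obtain ⟨t, ht, z, hz, hty⟩ := h.exists_mem_Ico (c - s / 4) y.2
      refine ⟨(t, ⟨z, hz⟩), ⟨⟨⟨ht.1, ?_⟩, mem_univ _⟩, fun hmem => hy ⟨_, hmem, Subtype.ext hty⟩⟩,
        Subtype.ext hty⟩
      have := ht.2
      simp only
      linarith
    · rintro ⟨p, ⟨hp, hpW⟩, rfl⟩ ⟨q, hq, hqp⟩
      have hq1 := (hsub hq).1
      obtain ⟨h1, h2⟩ := h.eq_of_abs_sub_lt q.2.2 p.2.2 (congrArg Subtype.val hqp) (by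
        rw [abs_lt]
        have := hp.1.1
        have := hp.1.2
        have := hq1.1
        have := hq1.2
        constructor <;> linarith)
      exact hpW (Prod.ext h1 (Subtype.ext h2) ▸ hq)
  rw [← isClosed_compl_iff, this]
  exact (((isCompact_Icc.prod isCompact_univ).diff hW).image continuous_suspend).isClosed

/-- The flow box around time `c`. -/
noncomputable def flowBox (φ : Flow ℝ X) (F : Set X) (s c : ℝ) (p : EuclideanSpace ℝ (Fin 1) × F) :
    flowSaturation φ F :=
  suspend φ F (c + s / 4 * p.1 0, p.2)

lemma abs_apply_zero_lt {v : EuclideanSpace ℝ (Fin 1)} (hv : v ∈ Metric.ball 0 1) :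
    |v 0| < 1 := by
  simpa [EuclideanSpace.norm_eq, Real.sqrt_sq_eq_abs] using hv

lemma flowBox_injOn (h : IsTransversal φ F s) (c : ℝ) :
    InjOn (flowBox φ F s c) (Metric.ball 0 1 ×ˢ univ) := by
  rintro ⟨v, z⟩ ⟨hv, -⟩ ⟨w, z'⟩ ⟨hw, -⟩ heq
  have hs := h.pos
  have hv' := abs_lt.1 (abs_apply_zero_lt hv)
  have hw' := abs_lt.1 (abs_apply_zero_lt hw)
  obtain ⟨h1, h2⟩ := h.eq_of_abs_sub_lt z.2 z'.2 (congrArg Subtype.val heq) (by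
    rw [abs_lt]; constructor <;> nlinarith)
  have h3 : v 0 = w 0 := by
    have : s / 4 * v 0 = s / 4 * w 0 := by simpa using h1
    exact mul_left_cancel₀ (by positivity) this
  refine Prod.ext ?_ (Subtype.ext h2)
  ext i
  rw [Subsingleton.elim i 0, h3]

/-- The chart of the saturation of a transversal inverse to a flow box. -/
noncomputable def chart [T2Space X] [Nonempty F] (h : IsTransversal φ F s) (c : ℝ) :
    OpenPartialHomeomorph (flowSaturation φ F) (EuclideanSpace ℝ (Fin 1) × F) :=
  (OpenPartialHomeomorph.ofContinuousOpenRestrict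
    ((h.flowBox_injOn c).toPartialEquiv (flowBox φ F s c) _)
    (by
      refine (continuous_suspend.comp (Continuous.prodMk ?_ continuous_snd)).continuousOn
      fun_prop)
    (by
      have hs := h.pos
      have ho : IsOpen (Metric.ball (0 : EuclideanSpace ℝ (Fin 1)) 1 ×ˢ (univ : Set F)) :=
        Metric.isOpen_ball.prod isOpen_univ
      intro W hW
      have hW' : IsOpen (Subtype.val '' W) := ho.isOpenMap_subtype_val W hW
      -- `A` inverts the affine change of time in `flowBox`, so the flow box image of `W` is the
      -- suspension of a preimage under `A`.
      let A : ℝ × F → EuclideanSpace ℝ (Fin 1) × F :=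
        fun p => (WithLp.toLp 2 fun _ => (p.1 - c) / (s / 4), p.2)
      have hA : Continuous A := by fun_prop
      convert h.isOpen_suspend_image (c := c) (hW'.preimage hA) ?_ using 1
      · ext y
        constructor
        · rintro ⟨p, hp, rfl⟩
          refine ⟨(c + s / 4 * p.1.1 0, p.1.2), ?_, rfl⟩
          refine ⟨p, hp, Prod.ext ?_ rfl⟩
          ext i
          rw [Subsingleton.elim i 0]
          simp only [A]
          field_simp
          ring
        · rintro ⟨⟨t, z⟩, ⟨p, hp, hpA⟩, rfl⟩
          refine ⟨p, hp, ?_⟩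
          change suspend φ F (c + s / 4 * p.1.1 0, p.1.2) = _
          rw [hpA]
          congr 2
          simp only [A]
          field_simp
          ring
      · rintro ⟨t, z⟩ ⟨p, hp, hpA⟩
        refine ⟨?_, mem_univ _⟩
        have := abs_lt.1 (abs_apply_zero_lt p.2.1)
        have ht : t = c + s / 4 * p.1.1 0 := by
          rw [hpA]
          simp only [A]
          field_simp
          ring
        simp only
        constructor <;> nlinarith)
    (Metric.isOpen_ball.prod isOpen_univ)).symm

lemma chart_target [T2Space X] [Nonempty F] (h : IsTransversal φ F s) (c : ℝ) :
    (h.chart c).target = Metric.ball 0 1 ×ˢ univ :=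
  rfl

lemma chart_symm_apply [T2Space X] [Nonempty F] (h : IsTransversal φ F s) (c : ℝ)
    (p : EuclideanSpace ℝ (Fin 1) × F) : (h.chart c).symm p = flowBox φ F s c p :=
  rfl

/-- The saturation of a totally disconnected perfect transversal is a solenoid. -/
theorem isSolenoidalManifold [T2Space X] [SecondCountableTopology X] (h : IsTransversal φ F s)
    (hne : F.Nonempty) (htd : IsTotallyDisconnected F) (hperf : PerfectSpace F) :
    IsSolenoidalManifold 1 (flowSaturation φ F) := by
  have := hne.to_subtype
  have := isCompact_iff_compactSpace.1 h.isCompact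
  have := h.compactSpace_saturation
  have hs := h.pos
  refine ⟨inferInstance, inferInstance, inferInstance, ℝ, fun _ => F, inferInstance,
    fun c => h.chart c, fun _ => ⟨inferInstance,
      totallyDisconnectedSpace_subtype_iff.2 htd, hperf⟩, fun c => h.chart_target c, ?_, ?_⟩
  · rintro ⟨y, t, z, hz, rfl⟩
    refine ⟨t, ?_⟩
    have : ((0 : EuclideanSpace ℝ (Fin 1)), (⟨z, hz⟩ : F)) ∈ (h.chart t).target := by
      rw [chart_target]; exact ⟨Metric.mem_ball_self one_pos, mem_univ _⟩
    have := (h.chart t).map_target this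
    rw [chart_symm_apply] at this
    convert this using 1
    simp [flowBox, suspend]
  · intro i j
    -- On an overlap, two times in boxes of half-width s/4 around j and i differ by a multiple l *
    -- s, whence |j - i - l * s| < s/2. So l is the integer nearest to (j - i)/s, the same at all
    -- points: the change of charts is a translation in time and the l-th return map on `F`.
    let k : ℤ := round ((j - i) / s)
    refine ⟨fun v _ => v + WithLp.toLp 2 fun _ => (j - i - k * s) / (s / 4),
      fun z => ⟨φ (k • s) z, h.mapsTo k z z.2⟩, ?_, fun _ => by fun_prop⟩
    rintro ⟨v, z⟩ hp
    have hp1 : (v, z) ∈ (h.chart j).target := hp.1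
    have hp2 : (h.chart j).symm (v, z) ∈ (h.chart i).source := hp.2
    obtain ⟨w, z', hw⟩ : ∃ w z', h.chart i ((h.chart j).symm (v, z)) = (w, z') := ⟨_, _, rfl⟩
    have hq := (h.chart i).map_source hp2
    have hinv := (h.chart i).left_inv hp2
    rw [hw] at hq hinv
    rw [hw]
    rw [chart_target] at hq hp1
    have hv' := abs_lt.1 (abs_apply_zero_lt hp1.1)
    have hw' := abs_lt.1 (abs_apply_zero_lt hq.1)
    rw [chart_symm_apply, chart_symm_apply] at hinv
    obtain ⟨l, hl, hz⟩ := h.exists_return z.2 z'.2 (congrArg Subtype.val hinv.symm)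
    have hlk : l = k := by
      symm
      rw [round_eq_iff, mem_Ico, le_div_iff₀ hs, div_lt_iff₀ hs]
      simp only at hl hv' hw'
      constructor <;> nlinarith
    subst hlk
    refine Prod.ext ?_ (Subtype.ext ?_)
    · ext a
      rw [Subsingleton.elim a 0]
      simp only [PiLp.add_apply]
      field_simp
      simp only at hl
      linarith
    · simpa only [zsmul_eq_mul] using hz

end IsTransversal

end CuspDynamics

namespace CuspDynamics

/-! ### Cusps of a finite cover and its closed horocycles -/

section Cover

variable {Γ' Γ : Subgroup PSL(2, ℝ)}

lemma endpointClass_horocycleFlow (t : ℝ) (y : UnitTangent Γ) :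
    endpointClass Γ (horocycleFlow Γ t y) = endpointClass Γ y := by
  obtain ⟨u, rfl⟩ := UnitTangent.mk_surjective Γ y
  change Quotient.mk _ ((u * unipotent t) • boundaryInfty) = Quotient.mk _ (u • boundaryInfty)
  rw [mul_smul, unipotent_smul_infty]

lemma boundaryCover_endpointClass (h : Γ' ≤ Γ) (y : UnitTangent Γ') :
    boundaryCover h (endpointClass Γ' y) = endpointClass Γ (UnitTangent.cover h y) := by
  obtain ⟨u, rfl⟩ := UnitTangent.mk_surjective Γ' y
  rfl

lemma finite_fiber_cover (h : Γ' ≤ Γ) (hfin : Γ'.relIndex Γ ≠ 0) (x : UnitTangent Γ) :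
    {y : UnitTangent Γ' | UnitTangent.cover h y = x}.Finite := by
  obtain ⟨u, rfl⟩ := UnitTangent.mk_surjective Γ x
  have : (Γ'.subgroupOf Γ).FiniteIndex := ⟨hfin⟩
  have : Finite (Γ ⧸ Γ'.subgroupOf Γ) := Subgroup.finite_quotient_of_finiteIndex
  -- The inverse turns the left cosets γΓ' of the quotient into the right cosets Γ'γ⁻¹ needed for
  -- the fibre.
  let f : Γ ⧸ Γ'.subgroupOf Γ → UnitTangent Γ' :=
    Quotient.lift (fun γ : Γ => UnitTangent.mk Γ' ((γ : PSL(2, ℝ))⁻¹ * u)) (by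
      intro a b hab
      have hab' := Subgroup.mem_subgroupOf.1 (QuotientGroup.leftRel_apply.1 hab)
      exact UnitTangent.mk_eq_mk_iff.2 ⟨_, hab', by simp [mul_assoc]⟩)
  refine (finite_range f).subset ?_
  intro y hy
  obtain ⟨v, rfl⟩ := UnitTangent.mk_surjective Γ' y
  obtain ⟨γ, hγ, rfl⟩ := UnitTangent.mk_eq_mk_iff.1 ((cover_mk h v).symm.trans hy)
  refine ⟨QuotientGroup.mk (⟨γ, hγ⟩⁻¹ : Γ), ?_⟩
  change UnitTangent.mk Γ' _ = _
  simp

lemma unipotent_nsmul (k : ℕ) (s : ℝ) : unipotent (k * s) = unipotent s ^ k := by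
  induction k with
  | zero => simp [unipotent_zero]
  | succ k ih => rw [Nat.cast_succ, add_mul, one_mul, unipotent_add, ih, pow_succ']

/-- By finite index, some positive power of the element of Γ that closes the horocycle lies in Γ'.
-/
lemma isPeriodic_of_cover (h : Γ' ≤ Γ) (hfin : Γ'.relIndex Γ ≠ 0) {y : UnitTangent Γ'}
    (hy : IsPeriodic (horocycleFlow Γ) (UnitTangent.cover h y)) :
    IsPeriodic (horocycleFlow Γ') y := by
  obtain ⟨u, rfl⟩ := UnitTangent.mk_surjective Γ' y
  obtain ⟨s, hs, hsy⟩ := hy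
  rw [cover_mk, horocycleFlow_mk_eq_iff] at hsy
  obtain ⟨k, hk, -, hmem⟩ := Subgroup.exists_pow_mem_of_relIndex_ne_zero hfin hsy
  refine ⟨k * s, by positivity, ?_⟩
  rw [horocycleFlow_mk_eq_iff, unipotent_nsmul, ← conj_pow]
  exact hmem.1

lemma IsPeriodic.of_mem_orbit {α : Type*} [TopologicalSpace α] {φ : Flow ℝ α} {x y : α}
    (hx : IsPeriodic φ x) (hy : y ∈ φ.orbit x) : IsPeriodic φ y := by
  obtain ⟨s, hs, hsx⟩ := hx
  obtain ⟨t, rfl⟩ := hy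
  refine ⟨s, hs, ?_⟩
  change φ s (φ t x) = φ t x
  rw [← φ.map_add, add_comm, φ.map_add, hsx]

/-- Closed horocycles of a cover lying over the same closed horocycle and ending in the same cusp
are equal. -/
lemma exists_horocycleFlow_eq [DiscreteTopology Γ] (h : Γ' ≤ Γ) {x : UnitTangent Γ}
    (hx : IsPeriodic (horocycleFlow Γ) x) {y y' : UnitTangent Γ'}
    (hy : UnitTangent.cover h y ∈ (horocycleFlow Γ).orbit x)
    (hy' : UnitTangent.cover h y' ∈ (horocycleFlow Γ).orbit x)
    (he : endpointClass Γ' y = endpointClass Γ' y') : ∃ t, horocycleFlow Γ' t y = y' := by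
  have hper := hx.of_mem_orbit hy
  have horb : ∃ t, horocycleFlow Γ t (UnitTangent.cover h y) = UnitTangent.cover h y' := by
    obtain ⟨a, ha⟩ := hy
    obtain ⟨b, hb⟩ := hy'
    change horocycleFlow Γ a x = _ at ha
    change horocycleFlow Γ b x = _ at hb
    refine ⟨b - a, ?_⟩
    rw [← ha, ← hb, ← Flow.map_add, sub_add_cancel]
  obtain ⟨t, ht⟩ := horb
  obtain ⟨v, rfl⟩ := UnitTangent.mk_surjective Γ' y
  obtain ⟨v', rfl⟩ := UnitTangent.mk_surjective Γ' y'
  rw [cover_mk] at hper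
  rw [cover_mk, cover_mk, horocycleFlow_mk, eq_comm, UnitTangent.mk_eq_mk_iff] at ht
  obtain ⟨γ, hγ, rfl⟩ := ht
  obtain ⟨⟨δ, hδ⟩, hδe⟩ := Quotient.exact he
  have hδe' : δ • (γ * (v * unipotent t)) • boundaryInfty = v • boundaryInfty := hδe
  rw [mul_smul, mul_smul, unipotent_smul_infty, smul_smul] at hδe'
  -- δγ ∈ Γ fixes the end of v, so it only slides v along its horocycle, by a time r.
  obtain ⟨r, hr⟩ := exists_unipotent_of_smul_eq hper (mul_mem (h hδ) hγ) hδe'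
  refine ⟨t + r, ?_⟩
  rw [horocycleFlow_mk, UnitTangent.mk_eq_mk_iff]
  refine ⟨δ, hδ, ?_⟩
  rw [unipotent_add, ← mul_assoc v, ← hr]
  simp only [mul_assoc]

/-- A class over ξ = Γu(∞) contains some γu(∞) with γ ∈ Γ, which is the end of Γ'γu. Conversely, a
point over x is again periodic, so its end is a cusp. -/
lemma cusps_over_eq_image (h : Γ' ≤ Γ) (hfin : Γ'.relIndex Γ ≠ 0) {x : UnitTangent Γ}
    (hx : IsPeriodic (horocycleFlow Γ) x) :
    {C | C ∈ cusps Γ' ∧ boundaryCover h C = endpointClass Γ x} =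
      endpointClass Γ' '' {y | UnitTangent.cover h y = x} := by
  ext C
  constructor
  · rintro ⟨-, hC⟩
    obtain ⟨u, rfl⟩ := UnitTangent.mk_surjective Γ x
    induction C using Quotient.inductionOn with
    | h η =>
      obtain ⟨⟨γ, hγ⟩, hη⟩ := Quotient.exact hC
      have hη' : γ • u • boundaryInfty = η := hη
      refine ⟨UnitTangent.mk Γ' (γ * u), ?_, ?_⟩
      · exact UnitTangent.mk_eq_mk_iff.2 ⟨γ, hγ, rfl⟩
      · rw [← hη', ← mul_smul]; rfl
  · rintro ⟨y, rfl, rfl⟩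
    exact ⟨endpointClass_mem_cusps (isPeriodic_of_cover h hfin hx),
      boundaryCover_endpointClass h y⟩

end Cover

/-! ### The fibers of the inverse limit -/

namespace InverseLimit

variable {Γ : Subgroup PSL(2, ℝ)} {Γn : ℕ → Subgroup PSL(2, ℝ)} {hanti : Antitone Γn}

lemma isEmbedding_coord :
    IsEmbedding (fun (y : InverseLimit Γn hanti) (n : ℕ) => y.1 n) :=
  IsEmbedding.subtypeVal

lemma isClosedEmbedding_coord [∀ n, DiscreteTopology (Γn n)] :
    IsClosedEmbedding (fun (y : InverseLimit Γn hanti) (n : ℕ) => y.1 n) := by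
  refine ⟨isEmbedding_coord, ?_⟩
  have : range (fun (y : InverseLimit Γn hanti) (n : ℕ) => y.1 n) =
      ⋂ n, {y | UnitTangent.cover (hanti n.le_succ) (y (n + 1)) = y n} := by
    ext y
    rw [mem_iInter]
    exact ⟨fun ⟨z, hz⟩ n => hz ▸ z.2 n, fun h => ⟨⟨y, h⟩, rfl⟩⟩
  rw [this]
  exact isClosed_iInter fun n => isClosed_eq
    ((continuous_cover _).comp (continuous_apply _)) (continuous_apply _)

instance : SecondCountableTopology (InverseLimit Γn hanti) :=
  isEmbedding_coord.secondCountableTopology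

instance [∀ n, DiscreteTopology (Γn n)] : T2Space (InverseLimit Γn hanti) :=
  inferInstanceAs (T2Space (Subtype _))

/-- The point of the inverse limit with coordinates `Γₙ u`. -/
def thread (hanti : Antitone Γn) (u : PSL(2, ℝ)) : InverseLimit Γn hanti :=
  ⟨fun n => UnitTangent.mk (Γn n) u, fun _ => rfl⟩

lemma cover_coord (y : InverseLimit Γn hanti) {i n : ℕ} (hin : i ≤ n) :
    UnitTangent.cover (hanti hin) (y.1 n) = y.1 i := by
  induction n, hin using Nat.le_induction with
  | base =>
    obtain ⟨u, hu⟩ := UnitTangent.mk_surjective _ (y.1 i)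
    rw [← hu, cover_mk]
  | succ n hin ih =>
    rw [← ih, ← y.2 n]
    obtain ⟨u, hu⟩ := UnitTangent.mk_surjective _ (y.1 (n + 1))
    rw [← hu]
    rfl

lemma cover_eq_proj (hle : ∀ n, Γn n ≤ Γ) (y : InverseLimit Γn hanti) (n : ℕ) :
    UnitTangent.cover (hle n) (y.1 n) = proj hanti hle y := by
  rw [proj, ← cover_coord y n.zero_le]
  obtain ⟨u, hu⟩ := UnitTangent.mk_surjective _ (y.1 n)
  rw [← hu]
  rfl

/-- The n-th coordinate determines all earlier ones, so each coordinate of the sequence is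
eventually constant. -/
lemma tendsto_of_coord_eq {w : ℕ → InverseLimit Γn hanti} {z : InverseLimit Γn hanti}
    (h : ∀ n, (w n).1 n = z.1 n) : Tendsto w atTop (𝓝 z) := by
  rw [isEmbedding_coord.tendsto_nhds_iff, tendsto_pi_nhds]
  intro i
  refine tendsto_const_nhds.congr' ?_
  filter_upwards [eventually_ge_atTop i] with n hn
  change z.1 i = (w n).1 i
  rw [← cover_coord z hn, ← cover_coord (w n) hn, h n]

lemma proj_horocycleFlow (hle : ∀ n, Γn n ≤ Γ) (t : ℝ) (y : InverseLimit Γn hanti) :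
    proj hanti hle (horocycleFlow Γn hanti t y) =
      CuspDynamics.horocycleFlow Γ t (proj hanti hle y) :=
  cover_horocycleFlow (hle 0) t (y.1 0)

/-- The end of a point of the inverse limit at level `n`. -/
noncomputable def cuspAt (n : ℕ) (y : InverseLimit Γn hanti) : MulAction.orbitRel.Quotient (Γn n) Boundary :=
  endpointClass (Γn n) (y.1 n)

lemma cuspAt_horocycleFlow (n : ℕ) (t : ℝ) (y : InverseLimit Γn hanti) :
    cuspAt n (horocycleFlow Γn hanti t y) = cuspAt n y :=
  endpointClass_horocycleFlow t (y.1 n)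

lemma boundaryCover_cuspAt {i n : ℕ} (hin : i ≤ n) (y : InverseLimit Γn hanti) :
    boundaryCover (hanti hin) (cuspAt n y) = cuspAt i y := by
  rw [cuspAt, cuspAt, boundaryCover_endpointClass, cover_coord]

/-- The points over `x` with the same ends as `y` at all levels. -/
def transversal (hle : ∀ n, Γn n ≤ Γ) (x : UnitTangent Γ) (y : InverseLimit Γn hanti) :
    Set (InverseLimit Γn hanti) :=
  {z | proj hanti hle z = x ∧ ∀ n, cuspAt n z = cuspAt n y}

/-- The points over the horocycle of `x` with the same ends as `y` at all levels. -/
def component (hle : ∀ n, Γn n ≤ Γ) (x : UnitTangent Γ) (y : InverseLimit Γn hanti) :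
    Set (InverseLimit Γn hanti) :=
  {z | proj hanti hle z ∈ (CuspDynamics.horocycleFlow Γ).orbit x ∧ ∀ n, cuspAt n z = cuspAt n y}

lemma mem_transversal {hle : ∀ n, Γn n ≤ Γ} {x : UnitTangent Γ} {y z : InverseLimit Γn hanti} :
    z ∈ transversal hle x y ↔ proj hanti hle z = x ∧ ∀ n, cuspAt n z = cuspAt n y :=
  Iff.rfl

lemma mem_component {hle : ∀ n, Γn n ≤ Γ} {x : UnitTangent Γ} {y z : InverseLimit Γn hanti} :
    z ∈ component hle x y ↔
      proj hanti hle z ∈ (CuspDynamics.horocycleFlow Γ).orbit x ∧ ∀ n, cuspAt n z = cuspAt n y :=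
  Iff.rfl

lemma flowSaturation_transversal (hle : ∀ n, Γn n ≤ Γ) (x : UnitTangent Γ)
    (y : InverseLimit Γn hanti) :
    flowSaturation (horocycleFlow Γn hanti) (transversal hle x y) = component hle x y := by
  ext z
  constructor
  · rintro ⟨t, z, ⟨rfl, hz⟩, rfl⟩
    refine ⟨?_, fun n => by rw [cuspAt_horocycleFlow, hz n]⟩
    rw [proj_horocycleFlow]
    exact Flow.mem_orbit _ _ _
  · rintro ⟨⟨t, ht⟩, hz⟩
    change CuspDynamics.horocycleFlow Γ t x = _ at ht
    refine ⟨t, horocycleFlow Γn hanti (-t) z,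
      ⟨?_, fun n => by rw [cuspAt_horocycleFlow, hz n]⟩, ?_⟩
    · rw [proj_horocycleFlow, ← ht, ← Flow.map_add, neg_add_cancel, Flow.map_zero_apply]
    · rw [← Flow.map_add, add_neg_cancel, Flow.map_zero_apply]

/-! ### Transversals and minimality of the components -/

section Compactness

variable [∀ n, DiscreteTopology (Γn n)] (hle : ∀ n, Γn n ≤ Γ)

/-- The inverse limit is closed in the product of its levels, and the conditions cut out a product
of finite sets. -/
lemma isCompact_transversal (hfin : ∀ n, (Γn n).relIndex Γ ≠ 0)
    (x : UnitTangent Γ) (y : InverseLimit Γn hanti) :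
    IsCompact (transversal hle x y) := by
  let E : ∀ n, Set (UnitTangent (Γn n)) := fun n =>
    {d | UnitTangent.cover (hle n) d = x ∧ endpointClass (Γn n) d = cuspAt n y}
  have hE : ∀ n, IsCompact (E n) := fun n =>
    ((finite_fiber_cover (hle n) (hfin n) x).subset fun _ h => h.1).isCompact
  have : transversal hle x y = (fun (y : InverseLimit Γn hanti) (n : ℕ) => y.1 n) ⁻¹' (univ.pi E) := by
    ext z
    simp only [mem_transversal, mem_preimage, mem_univ_pi]
    constructor
    · rintro ⟨hz, hz'⟩ n
      exact ⟨(cover_eq_proj hle z n).trans hz, hz' n⟩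
    · exact fun hz => ⟨(hz 0).1, fun n => (hz n).2⟩
  rw [this]
  exact isClosedEmbedding_coord.isCompact_preimage (isCompact_univ_pi hE)

/-- A connected subset has a connected, finite image at each level, hence a single point. -/
lemma isTotallyDisconnected_transversal (hfin : ∀ n, (Γn n).relIndex Γ ≠ 0)
    (x : UnitTangent Γ) (y : InverseLimit Γn hanti) :
    IsTotallyDisconnected (transversal hle x y) := by
  intro t ht hpre a ha b hb
  refine Subtype.ext (funext fun n => ?_)
  have hcont : Continuous fun z : InverseLimit Γn hanti => z.1 n :=
    (continuous_apply n).comp continuous_subtype_val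
  have hfinite : ((fun z : InverseLimit Γn hanti => z.1 n) '' t).Finite := by
    refine (finite_fiber_cover (hle n) (hfin n) x).subset ?_
    rintro _ ⟨z, hz, rfl⟩
    exact (cover_eq_proj hle z n).trans (ht hz).1
  by_contra hne
  exact (hpre.image _ hcont.continuousOn).infinite_of_nontrivial
    ⟨_, mem_image_of_mem _ ha, _, mem_image_of_mem _ hb, hne⟩ hfinite

/-- Ends are flow invariant, so returning to the transversal amounts to returning to x after
projection: the return times are the periods of x. -/
lemma exists_isTransversal [DiscreteTopology Γ]
    (hfin : ∀ n, (Γn n).relIndex Γ ≠ 0) {x : UnitTangent Γ}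
    (hx : IsPeriodic (CuspDynamics.horocycleFlow Γ) x) (y : InverseLimit Γn hanti) :
    ∃ s, IsTransversal (horocycleFlow Γn hanti) (transversal hle x y) s := by
  obtain ⟨s, hs, hper⟩ := exists_period hx
  refine ⟨s, isCompact_transversal hle hfin x y, hs, ?_, ?_⟩
  · rintro k z ⟨hz, hz'⟩
    refine ⟨?_, fun n => by rw [cuspAt_horocycleFlow, hz' n]⟩
    rw [proj_horocycleFlow, hz, hper]
    exact AddSubgroup.zsmul_mem_zmultiples s k
  · rintro z ⟨hz, -⟩ t ⟨ht, -⟩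
    rwa [proj_horocycleFlow, hz, hper] at ht

lemma isMinimalSet_component [DiscreteTopology Γ]
    (hfin : ∀ n, (Γn n).relIndex Γ ≠ 0) {x : UnitTangent Γ}
    (hx : IsPeriodic (CuspDynamics.horocycleFlow Γ) x) {y : InverseLimit Γn hanti}
    (hy : proj hanti hle y ∈ (CuspDynamics.horocycleFlow Γ).orbit x) :
    IsMinimalSet (horocycleFlow Γn hanti) (component hle x y) := by
  obtain ⟨s, hs⟩ := exists_isTransversal hle hfin hx y
  refine ⟨?_, ⟨y, hy, fun _ => rfl⟩, ?_, ?_⟩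
  · rw [← flowSaturation_transversal, isCompact_iff_compactSpace]
    exact hs.compactSpace_saturation
  · rintro t z ⟨hz, hz'⟩
    refine ⟨?_, fun n => by rw [← hz' n]; exact cuspAt_horocycleFlow n t z⟩
    exact (proj_horocycleFlow hle t z).symm ▸ Flow.mem_orbit_of_mem_orbit _ t hz
  · rintro L hL ⟨w, hw⟩ hcl hinv
    refine hL.antisymm fun z hz => ?_
    -- At level n, w and z lie on one closed horocycle. Flowing w for the resulting times tₙ gives
    -- points of L converging to z.
    have hlevel : ∀ n, ∃ t, CuspDynamics.horocycleFlow (Γn n) t (w.1 n) = z.1 n := fun n =>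
      exists_horocycleFlow_eq (hle n) hx (by rw [cover_eq_proj]; exact (hL hw).1)
        (by rw [cover_eq_proj]; exact hz.1) (((hL hw).2 n).trans (hz.2 n).symm)
    choose t ht using hlevel
    exact hcl.mem_of_tendsto (tendsto_of_coord_eq (w := fun n => horocycleFlow Γn hanti (t n) w) ht)
      (Eventually.of_forall fun n => hinv (t n) hw)

end Compactness

/-- By `hN`, a point over x that agrees with z up to level N stays in the transversal. Since the
indices grow, some γ ∈ Γₘ with m = max n N is not in a later Γₖ. Writing the k-th coordinate of z as
Γₖv, the thread of γv agrees with z up to level m and differs from it at level k. -/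
lemma perfectSpace_transversal (hle : ∀ n, Γn n ≤ Γ)
    (hindex : Tendsto (fun n => (Γn n).relIndex Γ) atTop atTop) {x : UnitTangent Γ}
    {y : InverseLimit Γn hanti} {N : ℕ}
    (hN : ∀ z, proj hanti hle z = x → cuspAt N z = cuspAt N y → ∀ n, cuspAt n z = cuspAt n y) :
    PerfectSpace (transversal hle x y) := by
  rw [perfectSpace_iff_forall_not_isolated]
  rintro ⟨z, hz⟩
  have hw : ∀ n, ∃ w ∈ transversal hle x y, w ≠ z ∧ w.1 n = z.1 n := by
    intro n
    obtain ⟨k, hk, hkn⟩ : ∃ k, max n N ≤ k ∧ (Γn (max n N)).relIndex Γ < (Γn k).relIndex Γ :=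
      ((eventually_ge_atTop (max n N)).and (hindex.eventually_gt_atTop _)).exists
    obtain ⟨γ, hγ, hγk⟩ : ∃ γ ∈ Γn (max n N), γ ∉ Γn k := by
      by_contra! hcon
      rw [le_antisymm (hanti hk) hcon] at hkn
      exact lt_irrefl _ hkn
    obtain ⟨v, hv⟩ := UnitTangent.mk_surjective _ (z.1 k)
    have hagree : ∀ i ≤ max n N, (thread hanti (γ * v)).1 i = z.1 i := by
      intro i hi
      rw [← cover_coord z (hi.trans hk), ← hv, cover_mk]
      exact UnitTangent.mk_eq_mk_iff.2 ⟨γ, hanti hi hγ, rfl⟩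
    have hproj : proj hanti hle (thread hanti (γ * v)) = x := by
      rw [← hz.1, proj, hagree 0 (Nat.zero_le _), proj]
    refine ⟨thread hanti (γ * v), ⟨hproj, hN _ hproj ?_⟩, ?_, hagree n (le_max_left _ _)⟩
    · rw [← hz.2 N, cuspAt, hagree N (le_max_right _ _), cuspAt]
    · intro heq
      have : UnitTangent.mk (Γn k) (γ * v) = UnitTangent.mk (Γn k) v := by
        rw [hv, ← heq]; rfl
      obtain ⟨δ, hδ, h⟩ := UnitTangent.mk_eq_mk_iff.1 this
      exact hγk (mul_right_cancel h ▸ hδ)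
  choose w hwt hwz hwn using hw
  have hlim : Tendsto (fun n => (⟨w n, hwt n⟩ : transversal hle x y)) atTop (𝓝 ⟨z, hz⟩) :=
    tendsto_subtype_rng.2 (tendsto_of_coord_eq hwn)
  have hlim' : Tendsto (fun n => (⟨w n, hwt n⟩ : transversal hle x y)) atTop (𝓝[≠] ⟨z, hz⟩) :=
    tendsto_nhdsWithin_iff.2 ⟨hlim, Eventually.of_forall fun n h =>
      hwz n (congrArg Subtype.val h)⟩
  exact hlim'.neBot

lemma isSolenoidalManifold_component [DiscreteTopology Γ] [∀ n, DiscreteTopology (Γn n)]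
    (hle : ∀ n, Γn n ≤ Γ) (hfin : ∀ n, (Γn n).relIndex Γ ≠ 0)
    (hindex : Tendsto (fun n => (Γn n).relIndex Γ) atTop atTop) {x : UnitTangent Γ}
    (hx : IsPeriodic (CuspDynamics.horocycleFlow Γ) x) {y : InverseLimit Γn hanti}
    (hy : proj hanti hle y ∈ (CuspDynamics.horocycleFlow Γ).orbit x) {N : ℕ}
    (hN : ∀ z, proj hanti hle z = x → cuspAt N z = cuspAt N y → ∀ n, cuspAt n z = cuspAt n y) :
    IsSolenoidalManifold 1 (component hle x y) := by
  obtain ⟨s, hs⟩ := exists_isTransversal hle hfin hx y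
  rw [← flowSaturation_transversal]
  refine hs.isSolenoidalManifold ?_ (isTotallyDisconnected_transversal hle hfin x y)
    (perfectSpace_transversal hle hindex hN)
  have : y ∈ flowSaturation (horocycleFlow Γn hanti) (transversal hle x y) := by
    rw [flowSaturation_transversal]
    exact ⟨hy, fun _ => rfl⟩
  obtain ⟨-, z, hz, -⟩ := this
  exact ⟨z, hz⟩

end InverseLimit

end CuspDynamics

namespace CuspDynamics.InverseLimit

/-! ### Counting cusps in the tower -/

section Counting

variable {Γ : Subgroup PSL(2, ℝ)} {Γn : ℕ → Subgroup PSL(2, ℝ)} {hanti : Antitone Γn}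

/-- The cusps at level `n` which lie over the cusp of a closed horocycle are the ends of the
points of the inverse limit over this horocycle. -/
lemma cusps_over_eq_cuspAt_image (hle : ∀ n, Γn n ≤ Γ) (hfin : ∀ n, (Γn n).relIndex Γ ≠ 0)
    {x : UnitTangent Γ} (hx : IsPeriodic (CuspDynamics.horocycleFlow Γ) x) (n : ℕ) :
    {C | C ∈ cusps (Γn n) ∧ boundaryCover (hle n) C = endpointClass Γ x} =
      cuspAt n '' (proj hanti hle ⁻¹' (CuspDynamics.horocycleFlow Γ).orbit x) := by
  rw [cusps_over_eq_image (hle n) (hfin n) hx]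
  ext C
  constructor
  · rintro ⟨d, hd, rfl⟩
    obtain ⟨u, rfl⟩ := UnitTangent.mk_surjective _ d
    refine ⟨thread hanti u, ?_, rfl⟩
    have : proj hanti hle (thread hanti u) = x := hd
    rw [mem_preimage, this]
    exact Flow.mem_orbit_self _ x
  · rintro ⟨y, ⟨t, ht⟩, rfl⟩
    change CuspDynamics.horocycleFlow Γ t x = _ at ht
    refine ⟨(horocycleFlow Γn hanti (-t) y).1 n, ?_, cuspAt_horocycleFlow n (-t) y⟩
    rw [mem_ofPred_eq, cover_eq_proj, proj_horocycleFlow, ← ht, ← Flow.map_add, neg_add_cancel,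
      Flow.map_zero_apply]

lemma numCuspsOver_eq_ncard (hanti : Antitone Γn) (hle : ∀ n, Γn n ≤ Γ)
    (hfin : ∀ n, (Γn n).relIndex Γ ≠ 0)
    {x : UnitTangent Γ} (hx : IsPeriodic (CuspDynamics.horocycleFlow Γ) x) (n : ℕ) :
    numCuspsOver (hle n) (endpointClass Γ x) =
      (cuspAt n '' (proj hanti hle ⁻¹' (CuspDynamics.horocycleFlow Γ).orbit x)).ncard := by
  rw [numCuspsOver, cusps_over_eq_cuspAt_image hle hfin hx]

/-- `ncard` is 0 on infinite sets, so the comparisons of cardinals that follow need this finiteness.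
-/
lemma finite_cuspAt_image (hle : ∀ n, Γn n ≤ Γ) (hfin : ∀ n, (Γn n).relIndex Γ ≠ 0)
    {x : UnitTangent Γ} (hx : IsPeriodic (CuspDynamics.horocycleFlow Γ) x) (n : ℕ) :
    (cuspAt n '' (proj hanti hle ⁻¹' (CuspDynamics.horocycleFlow Γ).orbit x)).Finite := by
  rw [← cusps_over_eq_cuspAt_image hle hfin hx, cusps_over_eq_image (hle n) (hfin n) hx]
  exact (finite_fiber_cover (hle n) (hfin n) x).image _

lemma boundaryCover_image_cuspAt_image (A : Set (InverseLimit Γn hanti)) {i n : ℕ} (hin : i ≤ n) :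
    boundaryCover (hanti hin) '' (cuspAt n '' A) = cuspAt i '' A := by
  rw [image_image]
  exact image_congr fun y _ => boundaryCover_cuspAt hin y

/-- If the number of ends of points of `A` is stationary from level `N` on, then the end at level
`N` of a point of `A` determines the ends at all levels. -/
lemma cuspAt_eq_of_ncard_le {A : Set (InverseLimit Γn hanti)}
    (hA : ∀ n, (cuspAt n '' A).Finite) {N : ℕ}
    (hN : ∀ n, (cuspAt n '' A).ncard ≤ (cuspAt N '' A).ncard)
    {y z : InverseLimit Γn hanti} (hy : y ∈ A) (hz : z ∈ A) (h : cuspAt N z = cuspAt N y)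
    (n : ℕ) : cuspAt n z = cuspAt n y := by
  have key : cuspAt (max n N) z = cuspAt (max n N) y := by
    -- The ends at level max n N map onto those at level N and are no more numerous, so this
    -- surjection of finite sets is injective.
    have hinj : InjOn (boundaryCover (hanti (le_max_right n N))) (cuspAt (max n N) '' A) := by
      refine injOn_of_ncard_image_eq (le_antisymm (ncard_image_le (hA _)) ?_) (hA _)
      rw [boundaryCover_image_cuspAt_image]
      exact hN _
    refine hinj (mem_image_of_mem _ hz) (mem_image_of_mem _ hy) ?_
    rwa [boundaryCover_cuspAt, boundaryCover_cuspAt]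
  rw [← boundaryCover_cuspAt (le_max_left n N), key, boundaryCover_cuspAt]

lemma component_eq_of_mem {hle : ∀ n, Γn n ≤ Γ} {x : UnitTangent Γ}
    {y z : InverseLimit Γn hanti} (h : z ∈ component hle x y) :
    component hle x z = component hle x y := by
  ext w
  simp only [mem_component, h.2]

end Counting

end CuspDynamics.InverseLimit

/-! ### The three cases -/

open CuspDynamics CuspDynamics.InverseLimit in
theorem theorem5p3
    (Γ : Subgroup PSL(2, ℝ)) (hΓ : CuspDynamics.IsNonuniformLattice Γ)
    (Γn : ℕ → Subgroup PSL(2, ℝ)) (hanti : Antitone Γn) (hle : ∀ n, Γn n ≤ Γ)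
    (hfin : ∀ n, (Γn n).relIndex Γ ≠ 0)
    (hindex : Tendsto (fun n => (Γn n).relIndex Γ) atTop atTop)
    (x : CuspDynamics.UnitTangent Γ)
    (hx : CuspDynamics.IsPeriodic (CuspDynamics.horocycleFlow Γ) x)
    (ξ : MulAction.orbitRel.Quotient Γ CuspDynamics.Boundary)
    (hξ : ξ = CuspDynamics.endpointClass Γ x)
    (c : ℕ → ℕ) (hc : ∀ n, c n = CuspDynamics.numCuspsOver (hle n) ξ)
    (M : Set (CuspDynamics.InverseLimit Γn hanti))
    (hM : M = CuspDynamics.InverseLimit.proj hanti hle ⁻¹'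
      (CuspDynamics.horocycleFlow Γ).orbit x) :
    Monotone c ∧
    ((∀ n, c n = 1) →
      CuspDynamics.IsSolenoidalManifold 1 M ∧
      CuspDynamics.IsMinimalSet (CuspDynamics.InverseLimit.horocycleFlow Γn hanti) M) ∧
    (∀ m : ℕ, IsGreatest (range c) m →
      ∃ K : Fin m → Set (CuspDynamics.InverseLimit Γn hanti),
        Pairwise (fun i j => Disjoint (K i) (K j)) ∧ ⋃ i, K i = M ∧
        ∀ i, CuspDynamics.IsSolenoidalManifold 1 (K i) ∧
          CuspDynamics.IsMinimalSet (CuspDynamics.InverseLimit.horocycleFlow Γn hanti) (K i)) ∧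
    (¬ BddAbove (range c) →
      ∃ 𝓕 : Set (Set (CuspDynamics.InverseLimit Γn hanti)),
        𝓕.Infinite ∧ 𝓕.PairwiseDisjoint id ∧ ⋃₀ 𝓕 = M ∧
        ∀ K ∈ 𝓕,
          CuspDynamics.IsMinimalSet (CuspDynamics.InverseLimit.horocycleFlow Γn hanti) K) := by
  have : DiscreteTopology Γ := hΓ.1.1
  have : ∀ n, DiscreteTopology (Γn n) := fun n => DiscreteTopology.of_subset ‹_› (hle n)
  have hcM : ∀ n, c n = (cuspAt n '' M).ncard := fun n => by
    rw [hc, hξ, hM, numCuspsOver_eq_ncard hanti hle hfin hx]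
  have hA : ∀ n, (cuspAt n '' M).Finite := fun n => hM ▸ finite_cuspAt_image hle hfin hx n
  have hmem : ∀ y, y ∈ M ↔ proj hanti hle y ∈ (CuspDynamics.horocycleFlow Γ).orbit x :=
    fun y => by rw [hM, mem_preimage]
  have hfiber : ∀ y, proj hanti hle y = x → y ∈ M := fun y hy => by
    rw [hmem, hy]; exact Flow.mem_orbit_self _ x
  have hself : ∀ y ∈ M, y ∈ component hle x y := fun y hy => ⟨(hmem y).1 hy, fun _ => rfl⟩
  have hsub : ∀ y, component hle x y ⊆ M := fun y z hz => (hmem z).2 hz.1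
  have hmin : ∀ y ∈ M, IsMinimalSet (InverseLimit.horocycleFlow Γn hanti) (component hle x y) :=
    fun y hy => isMinimalSet_component hle hfin hx ((hmem y).1 hy)
  have hstat : ∀ N, (∀ n, c n ≤ c N) → ∀ y ∈ M, ∀ z ∈ M, cuspAt N z = cuspAt N y →
      ∀ n, cuspAt n z = cuspAt n y := fun N hN y hy z hz h n =>
    cuspAt_eq_of_ncard_le hA (fun n => by rw [← hcM, ← hcM]; exact hN n) hy hz h n
  have hsol : ∀ N, (∀ n, c n ≤ c N) → ∀ y ∈ M, IsSolenoidalManifold 1 (component hle x y) :=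
    fun N hN y hy => isSolenoidalManifold_component hle hfin hindex hx ((hmem y).1 hy)
      fun z hz h => hstat N hN y hy z (hfiber z hz) h
  obtain ⟨u, hu⟩ := UnitTangent.mk_surjective Γ x
  have hy₀ : thread hanti u ∈ M := hfiber _ hu
  refine ⟨?_, fun hone => ?_, fun m hm => ?_, fun hunb => ?_⟩
  · refine monotone_nat_of_le_succ fun n => ?_
    rw [hcM, hcM, ← boundaryCover_image_cuspAt_image M n.le_succ]
    exact ncard_image_le (hA _)
  -- A constant sequence is stationary from level 0, where there is only one end, so 𝓜 is a single
  -- component.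
  · have hle0 : ∀ n, c n ≤ c 0 := fun n => by rw [hone, hone]
    have hcomp : component hle x (thread hanti u) = M := by
      refine (hsub _).antisymm fun z hz => ⟨(hmem z).1 hz, hstat 0 hle0 _ hy₀ z hz ?_⟩
      exact (ncard_le_one (hA 0)).1 (by rw [← hcM, hone]) _ (mem_image_of_mem _ hz) _
        (mem_image_of_mem _ hy₀)
    exact ⟨hcomp ▸ hsol 0 hle0 _ hy₀, hcomp ▸ hmin _ hy₀⟩
  · obtain ⟨⟨N, rfl⟩, hmax⟩ := hm
    have hN : ∀ n, c n ≤ c N := fun n => hmax (mem_range_self n)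
    have : Finite (cuspAt N '' M) := hA N
    -- The components are indexed by the ends at a level N where the maximum is attained.
    let f : Fin (c N) ≃ cuspAt N '' M :=
      (Finite.equivFinOfCardEq (by rw [hcM]; exact Nat.card_coe_set_eq _)).symm
    choose y hyM hyf using fun i => (f i).2
    refine ⟨fun i => component hle x (y i), fun i j hij => ?_, ?_,
      fun i => ⟨hsol N hN _ (hyM i), hmin _ (hyM i)⟩⟩
    · refine Set.disjoint_left.2 fun z hi hj => hij (f.injective (Subtype.ext ?_))
      rw [← hyf i, ← hyf j, ← hi.2 N, ← hj.2 N]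
    · refine (iUnion_subset fun i => hsub _).antisymm fun z hz => mem_iUnion.2 ?_
      obtain ⟨i, hi⟩ := f.surjective ⟨cuspAt N z, mem_image_of_mem _ hz⟩
      exact ⟨i, (hmem z).1 hz, hstat N hN _ (hyM i) z hz (by rw [hyf i, hi])⟩
  · refine ⟨component hle x '' M, fun hfinite => hunb ?_, ?_, ?_, ?_⟩
    -- Points with different ends at level n lie in different components, so a finite number of
    -- components would bound every cₙ.
    · refine ⟨(component hle x '' M).ncard, ?_⟩
      rintro _ ⟨n, rfl⟩
      have : Nonempty (InverseLimit Γn hanti) := ⟨thread hanti u⟩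
      choose! y hyM hyC using fun C (hC : C ∈ cuspAt n '' M) => hC
      rw [hcM]
      refine ncard_le_ncard_of_injOn (fun C => component hle x (y C))
        (fun C hC => mem_image_of_mem _ (hyM C hC)) (fun C hC C' hC' h => ?_) hfinite
      have : y C ∈ component hle x (y C') := by
        rw [← show component hle x (y C) = component hle x (y C') from h]
        exact hself _ (hyM C hC)
      rw [← hyC C hC, ← hyC C' hC', this.2 n]
    · rintro _ ⟨y, -, rfl⟩ _ ⟨y', -, rfl⟩ hne
      refine Set.disjoint_left.2 fun z h h' => hne ?_
      rw [← component_eq_of_mem h, ← component_eq_of_mem h']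
    · refine (sUnion_subset ?_).antisymm fun z hz => ⟨_, mem_image_of_mem _ hz, hself z hz⟩
      rintro _ ⟨y, -, rfl⟩
      exact hsub y
    · rintro _ ⟨y, hy, rfl⟩
      exact hmin y hy
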